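/- Let $M$ be a smooth manifold of dimension $n$ (Hausdorff, second countable, without boundary, not necessarily compact, connected or orientable), let $\mathcal F$ be a smooth foliation of $M$, and let $\Omega^r(M)$ be the space of smooth real $r$-forms. The set of basic forms is $$\Omega_b^r(M)=\{\beta\in\Omega^r(M): X\lrcorner\beta=0,\ X\lrcorner d\beta=0 \text{ for every smooth vector field } X \text{ tangent to } \mathcal F\}.$$ For a Riemannian metric $g$ on $M$ let $*$ be the Hodge star operator and let $\delta=(-1)^{nk+n+1}*d*$ on $\Omega^k(M)$ be the codifferential (computed with local orientations, on which it does not depend; $\delta=0$ on $\Omega^0(M)$). The space of antibasic $r$-forms is $$\Omega_a^r(M,g)=\Big\{\alpha\in\Omega^r(M):\ \int_M\langle\alpha,\beta\rangle_g\,d\mathrm{vol}_g \text{ converges absolutely and equals } 0 \text{ for all } \beta\in\Omega_b^r(M)\Big\},$$ and the antibasic cohomology is $$H_a^r(M,\mathcal F,g)=\frac{\{\psi\in\Omega_a^r(M,g):\delta\psi=0\}}{\{\psi\in\Omega_a^r(M,g):\psi=\delta\varphi\text{ for some }\varphi\in\Omega_a^{r+1}(M,g)\}}.$$ Let $H_{a,c}^r(M,\mathcal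 F,g)$ be defined in the same way with $\Omega_a^\bullet(M,g)$ replaced throughout by its subspace of compactly supported forms. (If $M$ is compact, the two groups coincide.) Theorem. For any two Riemannian metrics $g,g'$ on $M$, with Hodge star operators $*,*'$ (for the same local orientations), let $B^r=*'\,*^{-1}$, a bundle map on $r$-forms, where $*,*'$ are taken from $(n-r)$-forms to $r$-forms. Then for every $r$ the map $B^r$ carries $\delta$-closed $g$-antibasic $r$-forms to $\delta'$-closed $g'$-antibasic $r$-forms, and $[\psi]\mapsto[B^r\psi]$ is a well-defined linear isomorphism $$H_a^r(M,\mathcal F,g)\;\cong\;H_a^r(M,\mathcal F,g').$$ The same holds for $H_{a,c}^r$. In particular, the isomorphism classes of these groups do not depend on the metric. -/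

import Mathlib

open scoped Manifold ContDiff Topology Bundle
open MeasureTheory

noncomputable section

namespace AntibasicCohomology

/-! ### Linear algebra of a scalar product on coordinate space -/

/-- The model space `ℝⁿ`. -/
abbrev Coord (n : ℕ) : Type := EuclideanSpace ℝ (Fin n)

/-- Alternating `r`-linear forms on `ℝⁿ`. -/
abbrev AltForm (n r : ℕ) : Type := Coord n [⋀^Fin r]→L[ℝ] ℝ

/-- The standard basis vector `e_i` of `ℝⁿ`. -/
abbrev stdVec {n : ℕ} (i : Fin n) : Coord n := EuclideanSpace.single i (1 : ℝ)

/-- The component `β^{f_1 … f_k}` of the form `β`, all indices being raised by the scalar product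
with Gram matrix `A`. -/
def raisedComponent {n k : ℕ} (A : Matrix (Fin n) (Fin n) ℝ) (β : AltForm n k)
    (f : Fin k → Fin n) : ℝ :=
  ∑ h : Fin k → Fin n, (∏ i, A⁻¹ (f i) (h i)) * β (fun i => stdVec (h i))

/-- The scalar product on `k`-forms induced by the scalar product with Gram matrix `A`:
`⟨α, β⟩ = (1/k!) ∑ α_{f_1 … f_k} β^{f_1 … f_k}`. -/
def formInner {n k : ℕ} (A : Matrix (Fin n) (Fin n) ℝ) (α β : AltForm n k) : ℝ :=
  (k.factorial : ℝ)⁻¹ *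
    ∑ f : Fin k → Fin n, α (fun i => stdVec (f i)) * raisedComponent A β f

lemma append_update {n k l : ℕ} (u : Fin k → Coord n) [DecidableEq (Fin l)]
    (v : Fin l → Coord n) (i : Fin l) (x : Coord n) :
    Fin.append u (Function.update v i x) =
      Function.update (Fin.append u v) (Fin.natAdd k i) x := by
  funext j
  refine Fin.addCases (fun a => ?_) (fun a => ?_) j
  · have : Fin.castAdd l a ≠ Fin.natAdd k i := by
      intro h
      have := congrArg Fin.val h
      simp at this
      omega
    simp [Function.update_of_ne this]
  · by_cases h : a = i
    · subst h; simp
    · have h' : Fin.natAdd k a ≠ Fin.natAdd k i := by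
        intro h''; exact h (by simpa [Fin.ext_iff] using h'')
      simp [Function.update_of_ne h, Function.update_of_ne h']

/-- The `l`-form `v ↦ det (u_1, …, u_k, v_1, …, v_l)` on `ℝⁿ`, where `k + l = n`. -/
def detForm {n k l : ℕ} (h : k + l = n) (u : Fin k → Coord n) : AltForm n l where
  toFun v := (EuclideanSpace.basisFun (Fin n) ℝ).toBasis.det
    fun i => Fin.append u v (Fin.cast h.symm i)
  map_update_add' v i x y := by
    subst h
    simp only [append_update, Fin.cast_eq_self, AlternatingMap.map_update_add]
  map_update_smul' v i c x := by
    subst h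
    simp only [append_update, Fin.cast_eq_self, AlternatingMap.map_update_smul]
  map_eq_zero_of_eq' v i j hv hij := by
    subst h
    refine AlternatingMap.map_eq_zero_of_eq _ _ (i := Fin.natAdd k i) (j := Fin.natAdd k j) ?_ ?_
    · simpa using hv
    · intro h; exact hij (by simpa [Fin.ext_iff] using h)
  cont := by
    subst h
    have h1 : Continuous fun v : Fin l → Coord (k + l) => Fin.append u v := by
      refine continuous_pi fun j => ?_
      refine Fin.addCases (fun a => ?_) (fun a => ?_) j
      · simpa using continuous_const
      · simpa using continuous_apply a
    change Continuous fun v : Fin l → Coord (k + l) =>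
      (EuclideanSpace.basisFun (Fin (k + l)) ℝ).toBasis.det (Fin.append u v)
    simp only [Module.Basis.det_apply]
    refine Continuous.matrix_det (continuous_matrix fun i j => ?_)
    simp only [Module.Basis.toMatrix_apply, OrthonormalBasis.coe_toBasis_repr_apply,
      EuclideanSpace.basisFun_repr]
    have h2 : Continuous fun v : Fin l → Coord (k + l) => Fin.append u v j :=
      (continuous_apply j).comp h1
    fun_prop

/-- The Hodge star operator from `k`-forms to `l`-forms, `k + l = n`, of `ℝⁿ` with its standard
orientation and with the scalar product with Gram matrix `A`:
`(⋆β)(v_1, …, v_l) = (1/k!) √(det A) ∑ β^{f_1 … f_k} det (e_{f_1}, …, e_{f_k}, v_1, …, v_l)`.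
It is the operator with `α ∧ ⋆β = ⟨α, β⟩ vol`. It is set to `0` if `k + l ≠ n`. -/
def hodgeStar {n : ℕ} (A : Matrix (Fin n) (Fin n) ℝ) (k l : ℕ) (β : AltForm n k) : AltForm n l :=
  if h : k + l = n then
    ((k.factorial : ℝ)⁻¹ * √A.det) •
      ∑ f : Fin k → Fin n, raisedComponent A β f • detForm h (fun i => stdVec (f i))
  else 0

lemma raisedComponent_add {n k : ℕ} (A : Matrix (Fin n) (Fin n) ℝ) (β γ : AltForm n k)
    (f : Fin k → Fin n) :
    raisedComponent A (β + γ) f = raisedComponent A β f + raisedComponent A γ f := by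
  simp [raisedComponent, mul_add, Finset.sum_add_distrib]

lemma raisedComponent_smul {n k : ℕ} (A : Matrix (Fin n) (Fin n) ℝ) (c : ℝ) (β : AltForm n k)
    (f : Fin k → Fin n) : raisedComponent A (c • β) f = c * raisedComponent A β f := by
  simp only [raisedComponent, ContinuousAlternatingMap.smul_apply, smul_eq_mul, Finset.mul_sum]
  exact Finset.sum_congr rfl fun h _ => by ring

lemma formInner_add {n k : ℕ} (A : Matrix (Fin n) (Fin n) ℝ) (α β γ : AltForm n k) :
    formInner A (α + β) γ = formInner A α γ + formInner A β γ := by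
  simp [formInner, add_mul, mul_add, Finset.sum_add_distrib]

lemma formInner_smul {n k : ℕ} (A : Matrix (Fin n) (Fin n) ℝ) (c : ℝ) (α γ : AltForm n k) :
    formInner A (c • α) γ = c * formInner A α γ := by
  simp only [formInner, ContinuousAlternatingMap.smul_apply, smul_eq_mul, Finset.mul_sum]
  exact Finset.sum_congr rfl fun h _ => by ring

lemma hodgeStar_add {n : ℕ} (A : Matrix (Fin n) (Fin n) ℝ) (k l : ℕ) (β γ : AltForm n k) :
    hodgeStar A k l (β + γ) = hodgeStar A k l β + hodgeStar A k l γ := by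
  unfold hodgeStar
  split_ifs
  · simp only [raisedComponent_add, add_smul, Finset.sum_add_distrib, smul_add]
  · simp

lemma hodgeStar_smul {n : ℕ} (A : Matrix (Fin n) (Fin n) ℝ) (k l : ℕ) (c : ℝ) (β : AltForm n k) :
    hodgeStar A k l (c • β) = c • hodgeStar A k l β := by
  unfold hodgeStar
  split_ifs
  · simp only [raisedComponent_smul, mul_smul c, ← Finset.smul_sum]
    rw [smul_comm c]
  · simp

lemma differentiableAt_finsetProd {n : ℕ} {ι : Type*} [Fintype ι] {a : ι → Coord n → ℝ}
    {y : Coord n} (ha : ∀ i, DifferentiableAt ℝ (a i) y) :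
    DifferentiableAt ℝ (fun z => ∏ i, a i z) y := by
  classical
  exact (HasFDerivAt.finsetProd fun i _ => (ha i).hasFDerivAt).differentiableAt

lemma differentiableAt_det {n : ℕ} {A : Coord n → Matrix (Fin n) (Fin n) ℝ} {y : Coord n}
    (hA : ∀ i j, DifferentiableAt ℝ (fun z => A z i j) y) :
    DifferentiableAt ℝ (fun z => (A z).det) y := by
  simp only [Matrix.det_apply]
  fun_prop

lemma differentiableAt_inv {n : ℕ} {A : Coord n → Matrix (Fin n) (Fin n) ℝ} {y : Coord n}
    (hA : ∀ i j, DifferentiableAt ℝ (fun z => A z i j) y) (hdet : (A y).det ≠ 0) (i j : Fin n) :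
    DifferentiableAt ℝ (fun z => (A z)⁻¹ i j) y := by
  simp only [Matrix.inv_def, Ring.inverse_eq_inv', Matrix.smul_apply, smul_eq_mul,
    Matrix.adjugate_apply]
  refine ((differentiableAt_det hA).inv hdet).mul (differentiableAt_det fun a b => ?_)
  by_cases h : a = j
  · subst h; simp
  · simpa [Matrix.updateRow_ne h] using hA a b

lemma differentiableAt_hodgeStar {n : ℕ} {A : Coord n → Matrix (Fin n) (Fin n) ℝ} {y : Coord n}
    {k : ℕ} (l : ℕ) {β : Coord n → AltForm n k}
    (hA : ∀ i j, DifferentiableAt ℝ (fun z => A z i j) y) (hdet : (A y).det ≠ 0)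
    (hβ : DifferentiableAt ℝ β y) :
    DifferentiableAt ℝ (fun z => hodgeStar (A z) k l (β z)) y := by
  unfold hodgeStar
  split_ifs
  · have h1 : DifferentiableAt ℝ (fun z => √(A z).det) y := (differentiableAt_det hA).sqrt hdet
    have h2 (f : Fin k → Fin n) : DifferentiableAt ℝ (fun z => raisedComponent (A z) (β z) f) y := by
      unfold raisedComponent
      refine DifferentiableAt.fun_sum fun h _ => DifferentiableAt.mul ?_ ?_
      · exact differentiableAt_finsetProd fun i => differentiableAt_inv hA hdet _ _
      · exact (ContinuousAlternatingMap.apply ℝ (Coord n) ℝ _).differentiableAt.comp y hβ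
    exact (h1.const_mul _).smul (DifferentiableAt.fun_sum fun f _ => (h2 f).smul_const _)
  · exact differentiableAt_const _

/-! ### Differential forms on a manifold

In this section the model space is an arbitrary normed space `E`. -/

section Forms

variable {E : Type*} [NormedAddCommGroup E] [NormedSpace ℝ E]
  {M : Type*} [TopologicalSpace M] [ChartedSpace E M]

variable (E M) in
/-- Fields of alternating `r`-linear forms on the tangent spaces of `M`, with no regularity. -/
def FormField (r : ℕ) : Type _ := ∀ x : M, TangentSpace 𝓘(ℝ, E) x [⋀^Fin r]→L[ℝ] ℝ

instance (r : ℕ) : AddCommGroup (FormField E M r) :=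
  inferInstanceAs (AddCommGroup (∀ x : M, TangentSpace 𝓘(ℝ, E) x [⋀^Fin r]→L[ℝ] ℝ))

instance (r : ℕ) : Module ℝ (FormField E M r) :=
  inferInstanceAs (Module ℝ (∀ x : M, TangentSpace 𝓘(ℝ, E) x [⋀^Fin r]→L[ℝ] ℝ))

lemma FormField.add_apply {r : ℕ} (η θ : FormField E M r) (x : M) : (η + θ) x = η x + θ x := rfl

lemma FormField.smul_apply {r : ℕ} (c : ℝ) (η : FormField E M r) (x : M) :
    (c • η) x = c • η x := rfl

lemma FormField.zero_apply {r : ℕ} (x : M) : (0 : FormField E M r) x = 0 := rfl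

/-- The derivative at `y` of the parametrization of `M` inverse to the chart at `x₀`. -/
def paramDeriv (x₀ : M) (y : E) :
    E →L[ℝ] TangentSpace 𝓘(ℝ, E) ((extChartAt 𝓘(ℝ, E) x₀).symm y) :=
  mfderiv 𝓘(ℝ, E) 𝓘(ℝ, E) (extChartAt 𝓘(ℝ, E) x₀).symm y

/-- The derivative at `x` of the chart at `x₀`. -/
def chartDeriv (x₀ x : M) : TangentSpace 𝓘(ℝ, E) x →L[ℝ] E :=
  mfderiv 𝓘(ℝ, E) 𝓘(ℝ, E) (extChartAt 𝓘(ℝ, E) x₀) x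

/-- The expression of a field of forms in the chart at `x₀` (its pullback to `E`). -/
def inChart {r : ℕ} (x₀ : M) (η : FormField E M r) (y : E) : E [⋀^Fin r]→L[ℝ] ℝ :=
  (η ((extChartAt 𝓘(ℝ, E) x₀).symm y)).compContinuousLinearMap (paramDeriv x₀ y)

lemma inChart_add {r : ℕ} (x₀ : M) (η θ : FormField E M r) :
    inChart x₀ (η + θ) = fun y => inChart x₀ η y + inChart x₀ θ y := by
  funext y; rfl

lemma inChart_smul {r : ℕ} (x₀ : M) (c : ℝ) (η : FormField E M r) :
    inChart x₀ (c • η) = fun y => c • inChart x₀ η y := by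
  funext y; rfl

lemma inChart_zero {r : ℕ} (x₀ : M) :
    inChart x₀ (0 : FormField E M r) = fun _ => 0 := by
  funext y; rfl

variable (E M) in
/-- The space `Ω^r(M)` of smooth differential `r`-forms. -/
def smoothForms (r : ℕ) : Submodule ℝ (FormField E M r) where
  carrier := {η | ∀ x₀ : M, ContDiffOn ℝ ∞ (inChart x₀ η) (extChartAt 𝓘(ℝ, E) x₀).target}
  add_mem' {η θ} hη hθ x₀ := by
    rw [inChart_add]
    exact (hη x₀).add (hθ x₀)
  zero_mem' x₀ := by
    rw [inChart_zero]
    exact contDiffOn_const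
  smul_mem' c η hη x₀ := by
    rw [inChart_smul]
    exact (hη x₀).const_smul c

variable (E M) in
/-- The forms that vanish outside of some compact set. -/
def compactlySupported (r : ℕ) : Submodule ℝ (FormField E M r) where
  carrier := {η | ∃ K : Set M, IsCompact K ∧ ∀ x ∉ K, η x = 0}
  add_mem' := by
    rintro η θ ⟨K, hK, hη⟩ ⟨L, hL, hθ⟩
    refine ⟨K ∪ L, hK.union hL, fun x hx => ?_⟩
    rw [FormField.add_apply, hη x (fun h => hx (Or.inl h)), hθ x (fun h => hx (Or.inr h)), add_zero]
  zero_mem' := ⟨∅, isCompact_empty, fun _ _ => rfl⟩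
  smul_mem' := by
    rintro c η ⟨K, hK, hη⟩
    refine ⟨K, hK, fun x hx => ?_⟩
    rw [FormField.smul_apply, hη x hx, smul_zero]

/-- The exterior derivative `d`, computed at `x` in the chart at `x`. -/
def extD {r : ℕ} (η : FormField E M r) : FormField E M (r + 1) := fun x =>
  (extDeriv (inChart x η) (extChartAt 𝓘(ℝ, E) x x)).compContinuousLinearMap (chartDeriv x x)

/-- The contraction `X ⌟ η` with a vector field, which is zero on `0`-forms. -/
def contraction (X : ∀ x : M, TangentSpace 𝓘(ℝ, E) x) :
    {r : ℕ} → FormField E M r → FormField E M (r - 1)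
  | 0, _ => 0
  | r + 1, η => fun x => ContinuousAlternatingMap.curryLeft (E := E) (n := r) (η x) (X x)

/-- Smooth vector fields. -/
def IsSmoothField (X : ∀ x : M, TangentSpace 𝓘(ℝ, E) x) [IsManifold 𝓘(ℝ, E) ∞ M] : Prop :=
  ContMDiff 𝓘(ℝ, E) 𝓘(ℝ, E).tangent ∞ fun x => (⟨x, X x⟩ : TangentBundle 𝓘(ℝ, E) M)

lemma differentiableAt_inChart {r : ℕ} {η : FormField E M r} (hη : η ∈ smoothForms E M r) (x : M) :
    DifferentiableAt ℝ (inChart x η) (extChartAt 𝓘(ℝ, E) x x) :=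
  ((hη x).contDiffAt (extChartAt_target_mem_nhds x)).differentiableAt (by simp)

variable [IsManifold 𝓘(ℝ, E) ∞ M]

variable (E M) in
/-- Riemannian metrics on the smooth manifold `M`. -/
abbrev Metric : Type _ :=
  Bundle.ContMDiffRiemannianMetric 𝓘(ℝ, E) ∞ E (fun x : M => TangentSpace 𝓘(ℝ, E) x)

lemma contDiffOn_metric (g : Metric E M) (x₀ : M) (v w : E) :
    ContDiffOn ℝ ∞ (fun y => g.inner ((extChartAt 𝓘(ℝ, E) x₀).symm y)
      (paramDeriv x₀ y v) (paramDeriv x₀ y w)) (extChartAt 𝓘(ℝ, E) x₀).target := by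
  have hopen : IsOpen (extChartAt 𝓘(ℝ, E) x₀).target := isOpen_extChartAt_target x₀
  have hsymm : ContMDiffOn 𝓘(ℝ, E) 𝓘(ℝ, E) ∞ (extChartAt 𝓘(ℝ, E) x₀).symm
      (extChartAt 𝓘(ℝ, E) x₀).target := contMDiffOn_extChartAt_symm x₀
  have := IsManifold.of_le (I := 𝓘(ℝ, E)) (M := M) (m := 1) (n := ∞) (by simp)
  have hT := hsymm.contMDiffOn_tangentMapWithin (m := ∞) (by simp) hopen.uniqueMDiffOn
  have hvec (u : E) : ContMDiffOn 𝓘(ℝ, E) 𝓘(ℝ, E).tangent ∞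
      (fun y => (⟨(extChartAt 𝓘(ℝ, E) x₀).symm y, paramDeriv x₀ y u⟩ :
        TangentBundle 𝓘(ℝ, E) M)) (extChartAt 𝓘(ℝ, E) x₀).target := by
    have hc : ContMDiff 𝓘(ℝ, E) 𝓘(ℝ, E).tangent ∞
        (fun y : E => (⟨y, u⟩ : TangentBundle 𝓘(ℝ, E) E)) :=
      contMDiff_vectorSpace_iff_contDiff.2 contDiff_const
    refine (hT.comp hc.contMDiffOn (fun y hy => hy)).congr fun y hy => ?_
    simp only [Function.comp, tangentMapWithin, paramDeriv]
    rw [mfderivWithin_of_isOpen hopen hy]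
    rfl
  have hg := g.contMDiff.comp_contMDiffOn hsymm
  have h := ContMDiffOn.clm_bundle_apply₂ (F₁ := E) (F₂ := E) (F₃ := ℝ)
    (E₃ := Bundle.Trivial M ℝ) hg (hvec v) (hvec w)
  intro y hy
  have h' := h y hy
  rw [Bundle.contMDiffWithinAt_totalSpace] at h'
  exact h'.2.contDiffWithinAt

lemma paramDeriv_injective (x₀ : M) {y : E} (hy : y ∈ (extChartAt 𝓘(ℝ, E) x₀).target) {v : E}
    (hv : paramDeriv x₀ y v = 0) : v = 0 := by
  have := IsManifold.of_le (I := 𝓘(ℝ, E)) (M := M) (m := 1) (n := ∞) (by simp)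
  have h := mfderiv_extChartAt_comp_mfderivWithin_extChartAt_symm (I := 𝓘(ℝ, E)) hy
  rw [modelWithCornersSelf_coe, Set.range_id, mfderivWithin_univ] at h
  have h2 := DFunLike.congr_fun h v
  change _ = v at h2
  rw [← h2]
  change mfderiv 𝓘(ℝ, E) 𝓘(ℝ, E) (extChartAt 𝓘(ℝ, E) x₀) ((extChartAt 𝓘(ℝ, E) x₀).symm y)
    (paramDeriv x₀ y v) = 0
  rw [hv, map_zero]

end Forms

/-! ### Operators of a Riemannian metric -/

section Riemannian

variable {n : ℕ} {M : Type*} [TopologicalSpace M] [ChartedSpace (Coord n) M]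
  [IsManifold 𝓘(ℝ, Coord n) ∞ M]

/-- The Gram matrix `g(∂_i, ∂_j)` of the metric in the chart at `x₀`. -/
def metricInChart (g : Metric (Coord n) M) (x₀ : M) (y : Coord n) : Matrix (Fin n) (Fin n) ℝ :=
  Matrix.of fun i j => g.inner ((extChartAt 𝓘(ℝ, Coord n) x₀).symm y)
    (paramDeriv x₀ y (stdVec i)) (paramDeriv x₀ y (stdVec j))

/-- The Gram matrix of the metric on `T_x M`, in the basis of `T_x M` given by the chart at `x`
(`TangentSpace 𝓘(ℝ, ℝⁿ) x` is `ℝⁿ`, identified with `T_x M` through the chart at `x`). -/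
def metricAt (g : Metric (Coord n) M) (x : M) : Matrix (Fin n) (Fin n) ℝ :=
  Matrix.of fun i j => g.inner x (stdVec i : Coord n) (stdVec j : Coord n)

lemma differentiableAt_metricInChart (g : Metric (Coord n) M) (x : M) (i j : Fin n) :
    DifferentiableAt ℝ (fun y => metricInChart g x y i j) (extChartAt 𝓘(ℝ, Coord n) x x) :=
  ((contDiffOn_metric g x (stdVec i) (stdVec j)).contDiffAt
    (extChartAt_target_mem_nhds x)).differentiableAt (by simp)

lemma det_metricInChart_ne_zero (g : Metric (Coord n) M) (x₀ : M) {y : Coord n}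
    (hy : y ∈ (extChartAt 𝓘(ℝ, Coord n) x₀).target) : (metricInChart g x₀ y).det ≠ 0 := by
  intro h
  obtain ⟨v, hv, h0⟩ := Matrix.exists_mulVec_eq_zero_iff.2 h
  set p := (extChartAt 𝓘(ℝ, Coord n) x₀).symm y
  set w : Coord n := ∑ j, v j • stdVec j with hw
  have hz (i : Fin n) :
      g.inner p (paramDeriv x₀ y (stdVec i)) (paramDeriv x₀ y w) = 0 := by
    have := congrFun h0 i
    simp only [Matrix.mulVec, dotProduct, metricInChart, Matrix.of_apply, Pi.zero_apply] at this
    rw [hw, map_sum, map_sum, ← this]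
    refine Finset.sum_congr rfl fun j _ => ?_
    rw [map_smul, map_smul, smul_eq_mul, mul_comm]
  have hzz : g.inner p (paramDeriv x₀ y w) (paramDeriv x₀ y w) = 0 := by
    have hcomb : paramDeriv x₀ y w = ∑ j, v j • paramDeriv x₀ y (stdVec j) := by
      rw [hw, map_sum]
      exact Finset.sum_congr rfl fun j _ => map_smul _ _ _
    nth_rewrite 2 [hcomb]
    rw [map_sum]
    refine Finset.sum_eq_zero fun j _ => ?_
    rw [map_smul, g.symm, hz, smul_zero]
  have hw0 : w = 0 := by
    by_contra hne
    exact (g.pos p _ fun h => hne (paramDeriv_injective x₀ hy h)).ne' hzz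
  apply hv
  funext i
  have := congrArg (fun u : Coord n => u i) hw0
  simpa [hw, Pi.single_apply] using this

/-- The codifferential `δ = (-1)^{n k + n + 1} ⋆ d ⋆` on `k`-forms, `k = r + 1`, computed at `x` in
the chart at `x`, with the orientation of that chart. Since `⋆` enters twice, the result does not
depend on the orientation, and `M` need not be orientable. -/
def codiff (g : Metric (Coord n) M) {r : ℕ} (η : FormField (Coord n) M (r + 1)) :
    FormField (Coord n) M r := fun x =>
  ((-1 : ℝ) ^ (n * (r + 1) + n + 1) •
    hodgeStar (metricInChart g x (extChartAt 𝓘(ℝ, Coord n) x x)) (n - (r + 1) + 1) r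
      (extDeriv
        (fun y => hodgeStar (metricInChart g x y) (r + 1) (n - (r + 1)) (inChart x η y))
        (extChartAt 𝓘(ℝ, Coord n) x x))).compContinuousLinearMap (chartDeriv x x)

lemma codiff_add (g : Metric (Coord n) M) {r : ℕ} {η θ : FormField (Coord n) M (r + 1)}
    (hη : η ∈ smoothForms (Coord n) M (r + 1)) (hθ : θ ∈ smoothForms (Coord n) M (r + 1)) :
    codiff g (η + θ) = codiff g η + codiff g θ := by
  funext x
  have hd {ζ : FormField (Coord n) M (r + 1)} (hζ : ζ ∈ smoothForms (Coord n) M (r + 1)) :=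
    differentiableAt_hodgeStar (n - (r + 1)) (differentiableAt_metricInChart g x)
      (det_metricInChart_ne_zero g x (mem_extChartAt_target x)) (differentiableAt_inChart hζ x)
  simp only [codiff, inChart_add, hodgeStar_add, FormField.add_apply]
  rw [extDeriv_fun_add (hd hη) (hd hθ), hodgeStar_add, smul_add]
  rfl

lemma codiff_smul (g : Metric (Coord n) M) {r : ℕ} (c : ℝ) (η : FormField (Coord n) M (r + 1)) :
    codiff g (c • η) = c • codiff g η := by
  funext x
  simp only [codiff, inChart_smul, hodgeStar_smul, FormField.smul_apply]
  have h := extDeriv_smul (x := extChartAt 𝓘(ℝ, Coord n) x x) c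
    (fun y => hodgeStar (metricInChart g x y) (r + 1) (n - (r + 1)) (inChart x η y))
  rw [Pi.smul_def] at h
  rw [h, hodgeStar_smul, smul_comm]
  rfl

lemma codiff_zero (g : Metric (Coord n) M) (r : ℕ) :
    codiff g (0 : FormField (Coord n) M (r + 1)) = 0 := by
  simpa using codiff_smul g 0 (0 : FormField (Coord n) M (r + 1))

/-- The bundle map `B = ⋆' ⋆⁻¹` on `r`-forms, where `⋆` and `⋆'` are the Hodge star operators of `g`
and `g'` from `(n - r)`-forms to `r`-forms, for one and the same orientation of `T_x M`. -/
def starChange (g g' : Metric (Coord n) M) {r : ℕ} (η : FormField (Coord n) M r) :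
    FormField (Coord n) M r := fun x =>
  hodgeStar (metricAt g' x) (n - r) r
    (Function.invFun (hodgeStar (metricAt g x) (n - r) r) (η x))

/-- The pointwise scalar product of two forms. -/
def pointInner (g : Metric (Coord n) M) {r : ℕ} (α β : FormField (Coord n) M r) (x : M) : ℝ :=
  formInner (metricAt g x) (α x) (β x)

/-- The Riemannian volume of the domain of the chart at `x₀`: Lebesgue measure with density
`√(det g)`, transported to `M`. -/
def chartVolume [MeasurableSpace M] (g : Metric (Coord n) M) (x₀ : M) : Measure M :=
  ((volume.restrict (extChartAt 𝓘(ℝ, Coord n) x₀).target).withDensity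
    fun y => ENNReal.ofReal √(metricInChart g x₀ y).det).map (extChartAt 𝓘(ℝ, Coord n) x₀).symm

/-- The Riemannian volume measure. The measures `chartVolume g x₀` agree on the overlaps of the
charts, and their supremum is the measure that restricts to each of them. -/
def riemannianVolume [MeasurableSpace M] (g : Metric (Coord n) M) : Measure M :=
  ⨆ x₀ : M, chartVolume g x₀

/-- `α` and `β` are `L²`-orthogonal: the integral `⟨α, β⟩ = ∫_M ⟨α, β⟩_x dvol_g` converges
(absolutely) and is zero. -/
def L2Orthogonal [MeasurableSpace M] (g : Metric (Coord n) M) {r : ℕ}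
    (α β : FormField (Coord n) M r) : Prop :=
  Integrable (pointInner g α β) (riemannianVolume g) ∧
    ∫ x, pointInner g α β x ∂riemannianVolume g = 0

end Riemannian

/-! ### Foliations, basic and antibasic forms -/

/-- A smooth foliation with leaves of dimension `p` of an `n`-dimensional manifold, given by a
foliated atlas: the changes of coordinates are locally of the form `(x, y) ↦ (f(x, y), h(y))`, where
`y` stands for the last `n - p` coordinates. -/
structure Foliation (n p : ℕ) (M : Type*) [TopologicalSpace M] [ChartedSpace (Coord n) M] where
  dim_le : p ≤ n
  /-- The foliated charts. -/
  atlas : Set (OpenPartialHomeomorph M (Coord n))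
  smooth : ∀ e ∈ atlas, e ∈ IsManifold.maximalAtlas 𝓘(ℝ, Coord n) ∞ M
  covers : ∀ x : M, ∃ e ∈ atlas, x ∈ e.source
  compatible : ∀ e ∈ atlas, ∀ e' ∈ atlas, ∀ x ∈ e.source ∩ e'.source, ∃ U ∈ 𝓝 x,
    U ⊆ e.source ∩ e'.source ∧ ∀ y ∈ U, ∀ z ∈ U,
      (∀ i : Fin n, p ≤ (i : ℕ) → e y i = e z i) → ∀ i : Fin n, p ≤ (i : ℕ) → e' y i = e' z i

section Foliated

variable {n p : ℕ} {M : Type*} [TopologicalSpace M] [ChartedSpace (Coord n) M]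

/-- The derivative at `x` of a local chart of `M`. -/
def localChartDeriv {E : Type*} [NormedAddCommGroup E] [NormedSpace ℝ E] [ChartedSpace E M]
    (e : OpenPartialHomeomorph M E) (x : M) : TangentSpace 𝓘(ℝ, E) x →L[ℝ] E :=
  mfderiv 𝓘(ℝ, E) 𝓘(ℝ, E) e x

/-- The vector `v ∈ T_x M` is tangent to the leaf through `x`. -/
def Foliation.IsTangent (F : Foliation n p M) {x : M} (v : TangentSpace 𝓘(ℝ, Coord n) x) : Prop :=
  ∀ e ∈ F.atlas, x ∈ e.source → ∀ i : Fin n, p ≤ (i : ℕ) → localChartDeriv e x v i = 0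

variable [IsManifold 𝓘(ℝ, Coord n) ∞ M]

/-- The set `Ω_b^r(M)` of basic forms: the smooth forms `β` with `X ⌟ β = 0` and `X ⌟ dβ = 0` for
all smooth vector fields `X` tangent to the foliation. -/
def Foliation.basicForms (F : Foliation n p M) (r : ℕ) : Set (FormField (Coord n) M r) :=
  {β | β ∈ smoothForms (Coord n) M r ∧
    ∀ X : (∀ x : M, TangentSpace 𝓘(ℝ, Coord n) x), IsSmoothField X → (∀ x, F.IsTangent (X x)) →
      contraction X β = 0 ∧ contraction X (extD β) = 0}

/-- The space `Ω_a^r(M, g)` of antibasic forms: the smooth forms that are `L²`-orthogonal to all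
basic forms. -/
def Foliation.antibasicForms [MeasurableSpace M] (F : Foliation n p M) (g : Metric (Coord n) M)
    (r : ℕ) : Submodule ℝ (FormField (Coord n) M r) where
  carrier := {α | α ∈ smoothForms (Coord n) M r ∧ ∀ β ∈ F.basicForms r, L2Orthogonal g α β}
  add_mem' {α α'} hα hα' := by
    refine ⟨add_mem hα.1 hα'.1, fun β hβ => ?_⟩
    obtain ⟨h1, h2⟩ := hα.2 β hβ
    obtain ⟨h1', h2'⟩ := hα'.2 β hβ
    have h : pointInner g (α + α') β = fun x => pointInner g α β x + pointInner g α' β x := by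
      funext x
      exact formInner_add _ _ _ _
    refine ⟨h ▸ h1.add h1', ?_⟩
    rw [h, integral_add h1 h1', h2, h2', add_zero]
  zero_mem' := by
    refine ⟨zero_mem _, fun β _ => ?_⟩
    have h : pointInner g 0 β = fun _ => 0 := by
      funext x
      have h0 := formInner_smul (metricAt g x) 0 (0 : AltForm n r) (β x)
      rw [zero_smul, zero_mul] at h0
      exact h0
    exact ⟨h ▸ integrable_zero _ _ _, by rw [h]; simp⟩
  smul_mem' c α hα := by
    refine ⟨Submodule.smul_mem _ c hα.1, fun β hβ => ?_⟩
    obtain ⟨h1, h2⟩ := hα.2 β hβ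
    have h : pointInner g (c • α) β = fun x => c * pointInner g α β x := by
      funext x
      exact formInner_smul _ _ _ _
    refine ⟨h ▸ h1.const_mul c, ?_⟩
    rw [h, integral_const_mul, h2, mul_zero]

/-- The space of compactly supported antibasic forms. -/
def Foliation.compactAntibasicForms [MeasurableSpace M] (F : Foliation n p M)
    (g : Metric (Coord n) M) (r : ℕ) : Submodule ℝ (FormField (Coord n) M r) :=
  F.antibasicForms g r ⊓ compactlySupported (Coord n) M r

/-! ### Cohomology of the codifferential -/

/-- The smooth `r`-forms with `δη = 0` (all of them if `r = 0`). -/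
def coclosedForms (g : Metric (Coord n) M) : (r : ℕ) → Submodule ℝ (FormField (Coord n) M r)
  | 0 => smoothForms (Coord n) M 0
  | r + 1 =>
    { carrier := {η | η ∈ smoothForms (Coord n) M (r + 1) ∧ codiff g η = 0}
      add_mem' := fun {η θ} hη hθ =>
        ⟨add_mem hη.1 hθ.1, by rw [codiff_add g hη.1 hθ.1, hη.2, hθ.2, add_zero]⟩
      zero_mem' := ⟨zero_mem _, codiff_zero g r⟩
      smul_mem' := fun c η hη =>
        ⟨Submodule.smul_mem _ c hη.1, by rw [codiff_smul, hη.2, smul_zero]⟩ }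

/-- The forms `δη`, where `η` ranges over the smooth forms in `W`. -/
def codiffImage (g : Metric (Coord n) M) {r : ℕ}
    (W : Submodule ℝ (FormField (Coord n) M (r + 1))) :
    Submodule ℝ (FormField (Coord n) M r) where
  carrier := {θ | ∃ η ∈ W, η ∈ smoothForms (Coord n) M (r + 1) ∧ codiff g η = θ}
  add_mem' := by
    rintro _ _ ⟨η, hη, hs, rfl⟩ ⟨η', hη', hs', rfl⟩
    exact ⟨η + η', add_mem hη hη', add_mem hs hs', codiff_add g hs hs'⟩
  zero_mem' := ⟨0, zero_mem _, zero_mem _, codiff_zero g r⟩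
  smul_mem' := by
    rintro c _ ⟨η, hη, hs, rfl⟩
    exact ⟨c • η, W.smul_mem c hη, Submodule.smul_mem _ c hs, codiff_smul g c η⟩

variable (W : (r : ℕ) → Submodule ℝ (FormField (Coord n) M r))

/-- The `δ`-cocycles in a graded space `W` of forms. -/
def cocycles (g : Metric (Coord n) M) (r : ℕ) : Submodule ℝ (FormField (Coord n) M r) :=
  W r ⊓ coclosedForms g r

/-- The `δ`-cohomology of a graded space `W` of forms: the space of the `ψ ∈ W^r` with `δψ = 0`
modulo the space of those that are of the form `δφ` with `φ ∈ W^{r+1}`. -/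
abbrev Cohomology (g : Metric (Coord n) M) (r : ℕ) : Type _ :=
  cocycles W g r ⧸ (codiffImage g (W (r + 1))).comap (cocycles W g r).subtype

/-- The cohomology class of a cocycle. -/
def cohomologyClass (g : Metric (Coord n) M) (r : ℕ) : cocycles W g r →ₗ[ℝ] Cohomology W g r :=
  Submodule.mkQ _

end Foliated

/-- The antibasic cohomology `H_a^r(M, F, g)`. -/
abbrev antibasicCohomology {n p : ℕ} {M : Type*} [TopologicalSpace M] [ChartedSpace (Coord n) M]
    [IsManifold 𝓘(ℝ, Coord n) ∞ M] [MeasurableSpace M] (F : Foliation n p M)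
    (g : Metric (Coord n) M) (r : ℕ) : Type _ :=
  Cohomology (F.antibasicForms g) g r

/-- The antibasic cohomology with compact supports. -/
abbrev compactAntibasicCohomology {n p : ℕ} {M : Type*} [TopologicalSpace M]
    [ChartedSpace (Coord n) M] [IsManifold 𝓘(ℝ, Coord n) ∞ M] [MeasurableSpace M]
    (F : Foliation n p M) (g : Metric (Coord n) M) (r : ℕ) : Type _ :=
  Cohomology (F.compactAntibasicForms g) g r

end AntibasicCohomology

end

/-!
Let `A` and `A'` be the Gram matrices of `g` and `g'` in local coordinates. The map `B = ⋆' ⋆⁻¹` is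
`α ↦ √(det A / det A') • (A⁻¹ A')^* α`: it is smooth, and its inverse is `⋆ ⋆'⁻¹`. By definition
`B ⋆ = ⋆'`, and also `⋆' B = ⋆`, since `⋆` and `⋆'` are symmetric up to one and the same sign. Hence
`⋆' d ⋆' B = ⋆' d ⋆ = B ⋆ d ⋆`, that is, `δ' B = B δ`. On the other hand `⟨Bα, β⟩' dvol' =
⟨α, β⟩ dvol`, so `B` preserves the orthogonality to the basic forms, which do not depend on the
metric. Thus `B` is an isomorphism of complexes and induces one in cohomology.
-/

noncomputable section

namespace AntibasicCohomology

/-! ### Coordinates of alternating forms -/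

lemma multilinearMap_sum_smul {R ι κ M N : Type*} [CommSemiring R] [Fintype ι] [DecidableEq ι]
    [Fintype κ] [AddCommMonoid M] [Module R M] [AddCommMonoid N] [Module R N]
    (β : MultilinearMap R (fun _ : ι => M) N) (c : ι → κ → R) (b : κ → M) :
    β (fun i => ∑ j, c i j • b j) = ∑ h : ι → κ, (∏ i, c i (h i)) • β (fun i => b (h i)) := by
  rw [β.map_sum]
  exact Finset.sum_congr rfl fun h _ => β.map_smul_univ _ _

section AltForm

variable {n k l : ℕ}

lemma altForm_ext {α β : AltForm n k}
    (h : ∀ f : Fin k → Fin n, f.Injective →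
      α (fun i => stdVec (f i)) = β (fun i => stdVec (f i))) : α = β := by
  refine ContinuousAlternatingMap.toAlternatingMap_injective
    ((EuclideanSpace.basisFun (Fin n) ℝ).toBasis.ext_alternating fun f hf => ?_)
  simpa using h f hf

/-- The components `α_{f_1 … f_k}` of a form. They are indexed by all index maps, so that the
components of a form are redundant. -/
def components (n k : ℕ) : AltForm n k →L[ℝ] ((Fin k → Fin n) → ℝ) :=
  ContinuousLinearMap.pi fun f =>
    ContinuousAlternatingMap.apply ℝ (Coord n) ℝ fun i => stdVec (f i)

lemma components_injective : Function.Injective (components n k) :=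
  fun _ _ h => altForm_ext fun f _ => congrFun h f

instance finiteDimensional_altForm : FiniteDimensional ℝ (AltForm n k) :=
  Module.Finite.of_injective (components n k).toLinearMap components_injective

lemma subsingleton_altForm (h : n < k) : Subsingleton (AltForm n k) where
  allEq _ _ := altForm_ext fun f hf => absurd (Fintype.card_le_of_injective f hf) (by simpa)

/-- The pullback `L^* α = α(L ·, …, L ·)` of forms on `ℝⁿ` by the linear map with matrix `L`. -/
def matPullback (L : Matrix (Fin n) (Fin n) ℝ) : AltForm n k →L[ℝ] AltForm n k :=
  ContinuousAlternatingMap.compContinuousLinearMapCLM (Matrix.toEuclideanCLM (𝕜 := ℝ) L)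

lemma matPullback_apply (L : Matrix (Fin n) (Fin n) ℝ) (α : AltForm n k) (v : Fin k → Coord n) :
    matPullback L α v = α fun i => Matrix.toEuclideanCLM (𝕜 := ℝ) L (v i) := rfl

lemma matPullback_matPullback (L L' : Matrix (Fin n) (Fin n) ℝ) (α : AltForm n k) :
    matPullback L (matPullback L' α) = matPullback (L' * L) α := by
  ext v
  simp only [matPullback_apply, map_mul, mul_apply_eq_comp]

lemma matPullback_one (α : AltForm n k) :
    matPullback (1 : Matrix (Fin n) (Fin n) ℝ) α = α := by
  ext v
  simp only [matPullback_apply, map_one, one_apply_eq_self]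

lemma toEuclideanCLM_stdVec (L : Matrix (Fin n) (Fin n) ℝ) (j : Fin n) :
    Matrix.toEuclideanCLM (𝕜 := ℝ) L (stdVec j) = ∑ i, L i j • stdVec i := by
  ext i
  simp [Pi.single_apply]

lemma matPullback_stdVec (L : Matrix (Fin n) (Fin n) ℝ) (α : AltForm n k) (f : Fin k → Fin n) :
    matPullback L α (fun i => stdVec (f i)) =
      ∑ h : Fin k → Fin n, (∏ i, L (h i) (f i)) * α (fun i => stdVec (h i)) := by
  simp only [matPullback_apply, toEuclideanCLM_stdVec]
  exact multilinearMap_sum_smul α.toMultilinearMap (fun i j => L j (f i)) stdVec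

end AltForm

/-! ### Determinants of rearranged basis vectors -/

lemma basis_det_comp_ne_zero_iff {R M ι : Type*} [CommRing R] [Nontrivial R] [AddCommGroup M]
    [Module R M] [Fintype ι] [DecidableEq ι] (b : Module.Basis ι R M) (φ : ι → ι) :
    b.det (b ∘ φ) ≠ 0 ↔ φ.Injective := by
  refine ⟨fun h => ?_, fun h => ?_⟩
  · by_contra hφ
    exact h (b.det.map_eq_zero_of_not_injective _ fun hinj => hφ hinj.of_comp)
  · obtain ⟨σ, rfl⟩ : ∃ σ : Equiv.Perm ι, ⇑σ = φ :=
      ⟨Equiv.ofBijective φ (Finite.injective_iff_bijective.1 h), rfl⟩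
    rw [b.det.map_perm, b.det_self, Units.smul_def]
    rcases Int.units_eq_one_or (Equiv.Perm.sign σ) with hσ | hσ <;> simp [hσ]

lemma exists_perm_comp_eq_of_append {k l : ℕ} {α : Type*} {f f' : Fin k → α} {g : Fin l → α}
    (hf : (Fin.append f g).Surjective) (hf' : (Fin.append f' g).Injective) :
    ∃ σ : Equiv.Perm (Fin k), f ∘ σ = f' := by
  rw [Fin.append_injective_iff] at hf'
  have hmem (i : Fin k) : ∃ j, f j = f' i := by
    obtain ⟨j, hj⟩ := hf (f' i)
    induction j using Fin.addCases with
    | left j => exact ⟨j, by simpa using hj⟩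
    | right j => exact absurd (by simpa using hj.symm) (hf'.2.2 i j)
  choose σ hσ using hmem
  have hinj : σ.Injective := fun i j h => hf'.1 (by rw [← hσ i, ← hσ j, h])
  exact ⟨Equiv.ofBijective σ (Finite.injective_iff_bijective.1 hinj), funext hσ⟩

lemma exists_injective_append {k l : ℕ} {α : Type*} [Fintype α] (h : k + l = Fintype.card α)
    {f : Fin k → α} (hf : f.Injective) : ∃ g : Fin l → α, (Fin.append f g).Injective := by
  classical
  have hcard : Fintype.card {a // a ∉ Set.range f} = l := by
    have hrange : Fintype.card {a // a ∈ Set.range f} = k := by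
      rw [← Fintype.card_congr (Equiv.ofInjective f hf), Fintype.card_fin]
    rw [Fintype.card_subtype_compl, hrange, ← h, Nat.add_sub_cancel_left]
  let e := (Fintype.equivFinOfCardEq hcard).symm
  refine ⟨fun j => e j, Fin.append_injective_iff.2
    ⟨hf, Subtype.val_injective.comp e.injective, fun i j hij => (e j).2 ⟨i, hij⟩⟩⟩

section DetForm

variable {n k l : ℕ}

lemma detForm_apply (h : k + l = n) (u : Fin k → Coord n) (v : Fin l → Coord n) :
    detForm h u v = (EuclideanSpace.basisFun (Fin n) ℝ).toBasis.det
      fun i => Fin.append u v (Fin.cast h.symm i) := rfl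

lemma detForm_stdVec_ne_zero_iff (h : k + l = n) (f : Fin k → Fin n) (g : Fin l → Fin n) :
    detForm h (fun i => stdVec (f i)) (fun i => stdVec (g i)) ≠ 0 ↔
      (Fin.append f g).Injective := by
  subst h
  rw [← basis_det_comp_ne_zero_iff (EuclideanSpace.basisFun (Fin (k + l)) ℝ).toBasis, detForm_apply]
  have happend : Fin.append (fun i => stdVec (f i)) (fun i => stdVec (g i)) =
      (EuclideanSpace.basisFun (Fin (k + l)) ℝ).toBasis ∘ Fin.append f g := by
    funext j
    induction j using Fin.addCases <;> simp
  simp only [Fin.cast_eq_self, happend]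

lemma detForm_toEuclideanCLM (h : k + l = n) (L : Matrix (Fin n) (Fin n) ℝ)
    (u : Fin k → Coord n) (v : Fin l → Coord n) :
    detForm h (fun i => Matrix.toEuclideanCLM (𝕜 := ℝ) L (u i))
      (fun i => Matrix.toEuclideanCLM (𝕜 := ℝ) L (v i)) = L.det * detForm h u v := by
  subst h
  set T := Matrix.toEuclideanCLM (𝕜 := ℝ) L with hT
  have hdet : LinearMap.det T.toLinearMap = L.det := by
    rw [hT, Matrix.coe_toEuclideanCLM_eq_toEuclideanLin,
      Matrix.toEuclideanLin_eq_toLin_orthonormal, LinearMap.det_toLin]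
  rw [detForm_apply, detForm_apply, ← hdet, ← Module.Basis.det_comp]
  congr 1
  funext j
  induction j using Fin.addCases <;> simp

lemma exists_detForm_swap (h : k + l = n) :
    ∃ ε : ℤˣ, ∀ (u : Fin k → Coord n) (v : Fin l → Coord n),
      detForm h u v = ε • detForm ((add_comm l k).trans h) v u := by
  subst h
  refine ⟨Equiv.Perm.sign (finAddFlip.trans (finCongr (add_comm l k))), fun u v => ?_⟩
  rw [detForm_apply, detForm_apply, ← AlternatingMap.map_perm]
  congr 1
  funext j
  induction j using Fin.addCases <;> simp

end DetForm

lemma detForm_comp_perm {n k l : ℕ} (h : k + l = n) (u : Fin k → Coord n) (v : Fin l → Coord n)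
    (σ : Equiv.Perm (Fin k)) :
    detForm h (u ∘ σ) v = Equiv.Perm.sign σ • detForm h u v := by
  obtain ⟨ε, hε⟩ := exists_detForm_swap h
  rw [hε, hε, smul_comm]
  exact congrArg (ε • ·)
    ((detForm ((add_comm l k).trans h) v).toAlternatingMap.map_perm u σ)

/-! ### The Hodge star operator on coordinate space -/

section HodgeStar

variable {n k l : ℕ} {A : Matrix (Fin n) (Fin n) ℝ}

lemma raisedComponent_eq_matPullback (hA : A.IsSymm) (β : AltForm n k) (f : Fin k → Fin n) :
    raisedComponent A β f = matPullback A⁻¹ β fun i => stdVec (f i) := by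
  simp only [raisedComponent, matPullback_stdVec, hA.inv.apply]

lemma raisedComponent_one (β : AltForm n k) (f : Fin k → Fin n) :
    raisedComponent 1 β f = β fun i => stdVec (f i) := by
  rw [raisedComponent_eq_matPullback Matrix.isSymm_one, inv_one, matPullback_one]

lemma formInner_one_apply (α β : AltForm n k) :
    formInner 1 α β = (k.factorial : ℝ)⁻¹ *
      ∑ f : Fin k → Fin n, α (fun i => stdVec (f i)) * β (fun i => stdVec (f i)) := by
  simp only [formInner, raisedComponent_one]

lemma formInner_eq_formInner_one (hA : A.IsSymm) (α β : AltForm n k) :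
    formInner A α β = formInner 1 α (matPullback A⁻¹ β) := by
  simp only [formInner, raisedComponent_one, raisedComponent_eq_matPullback hA]

lemma formInner_one_matPullback_left (L : Matrix (Fin n) (Fin n) ℝ) (α β : AltForm n k) :
    formInner 1 (matPullback L α) β = formInner 1 α (matPullback L.transpose β) := by
  simp only [formInner_one_apply, matPullback_stdVec, Finset.sum_mul, Finset.mul_sum,
    Matrix.transpose_apply]
  rw [Finset.sum_comm]
  exact Finset.sum_congr rfl fun f _ => Finset.sum_congr rfl fun h _ => by ring

lemma hodgeStar_of_add_ne (h : k + l ≠ n) (β : AltForm n k) : hodgeStar A k l β = 0 :=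
  dif_neg h

lemma hodgeStar_eq_hodgeStar_one (hA : A.IsSymm) (β : AltForm n k) :
    hodgeStar A k l β = √A.det • hodgeStar 1 k l (matPullback A⁻¹ β) := by
  by_cases h : k + l = n
  · simp only [hodgeStar, dif_pos h, raisedComponent_one, raisedComponent_eq_matPullback hA,
      Matrix.det_one, Real.sqrt_one, mul_one, smul_smul, mul_comm]
  · rw [hodgeStar_of_add_ne h, hodgeStar_of_add_ne h, smul_zero]

lemma hodgeStar_one_apply (h : k + l = n) (β : AltForm n k) (v : Fin l → Coord n) :
    hodgeStar 1 k l β v = (k.factorial : ℝ)⁻¹ *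
      ∑ f : Fin k → Fin n, β (fun i => stdVec (f i)) * detForm h (fun i => stdVec (f i)) v := by
  simp only [hodgeStar, dif_pos h, raisedComponent_one, Matrix.det_one, Real.sqrt_one, mul_one,
    ContinuousAlternatingMap.smul_apply, ContinuousAlternatingMap.sum_apply, smul_eq_mul]

lemma exists_hodgeStar_one_apply_eq_formInner (h : k + l = n) :
    ∃ ε : ℤˣ, ∀ (β : AltForm n k) (v : Fin l → Coord n),
      hodgeStar 1 k l β v = ε • formInner 1 (detForm ((add_comm l k).trans h) v) β := by
  obtain ⟨ε, hε⟩ := exists_detForm_swap h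
  refine ⟨ε, fun β v => ?_⟩
  simp only [hodgeStar_one_apply h, formInner_one_apply, hε, Units.smul_def, zsmul_eq_mul,
    Finset.mul_sum]
  exact Finset.sum_congr rfl fun f _ => by ring

lemma matPullback_detForm (h : k + l = n) (L : Matrix (Fin n) (Fin n) ℝ) (u : Fin k → Coord n) :
    matPullback L (detForm h fun i => Matrix.toEuclideanCLM (𝕜 := ℝ) L (u i)) =
      L.det • detForm h u := by
  ext v
  exact detForm_toEuclideanCLM h L u v

lemma matPullback_hodgeStar_one_matPullback (L : Matrix (Fin n) (Fin n) ℝ) (β : AltForm n k) :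
    matPullback L (hodgeStar 1 k l (matPullback L.transpose β)) = L.det • hodgeStar 1 k l β := by
  by_cases h : k + l = n
  · obtain ⟨ε, hε⟩ := exists_hodgeStar_one_apply_eq_formInner h
    ext v
    rw [matPullback_apply, hε, ← formInner_one_matPullback_left, matPullback_detForm,
      formInner_smul, ContinuousAlternatingMap.smul_apply, hε, smul_eq_mul, mul_smul_comm]
  · rw [hodgeStar_of_add_ne h, hodgeStar_of_add_ne h, map_zero, smul_zero]

lemma hodgeStar_eq_matPullback (hA : A.PosDef) (β : AltForm n k) :
    hodgeStar A k l β = (√A.det)⁻¹ • matPullback A (hodgeStar 1 k l β) := by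
  have hsymm : A.IsSymm := Matrix.isHermitian_iff_isSymm.1 hA.isHermitian
  have hdet : A.det ≠ 0 := hA.det_pos.ne'
  have hstar := matPullback_hodgeStar_one_matPullback (l := l) A (matPullback A⁻¹ β)
  rw [hsymm.eq, matPullback_matPullback, Matrix.nonsing_inv_mul A hdet.isUnit,
    matPullback_one] at hstar
  rw [hodgeStar_eq_hodgeStar_one hsymm, hstar, smul_smul, inv_mul_eq_div, Real.div_sqrt]

lemma hodgeStar_one_apply_stdVec (h : k + l = n) (β : AltForm n k) {f : Fin k → Fin n}
    {g : Fin l → Fin n} (hfg : (Fin.append f g).Injective) :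
    hodgeStar 1 k l β (fun i => stdVec (g i)) = β (fun i => stdVec (f i)) *
      detForm h (fun i => stdVec (f i)) (fun i => stdVec (g i)) := by
  subst h
  let T (f' : Fin k → Fin (k + l)) : ℝ := β (fun i => stdVec (f' i)) *
    detForm rfl (fun i => stdVec (f' i)) (fun i => stdVec (g i))
  have hzero (f' : Fin k → Fin (k + l))
      (hf' : f' ∉ Set.range fun σ : Equiv.Perm (Fin k) => f ∘ σ) : T f' = 0 := by
    refine mul_eq_zero_of_right _ (not_ne_iff.1 fun hne => hf' ?_)
    exact exists_perm_comp_eq_of_append (Finite.surjective_of_injective hfg)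
      ((detForm_stdVec_ne_zero_iff rfl f' g).1 hne)
  have hperm (σ : Equiv.Perm (Fin k)) : T (f ∘ σ) = T f := by
    have hβ : β (fun i => stdVec (f (σ i))) =
        Equiv.Perm.sign σ • β fun i => stdVec (f i) :=
      β.toAlternatingMap.map_perm (fun i => stdVec (f i)) σ
    have hdet : detForm rfl (fun i => stdVec (f (σ i))) (fun i => stdVec (g i)) =
        Equiv.Perm.sign σ • detForm rfl (fun i => stdVec (f i)) fun i => stdVec (g i) :=
      detForm_comp_perm rfl (fun i => stdVec (f i)) _ σ
    simp only [T, Function.comp_apply]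
    rw [hβ, hdet, smul_mul_smul_comm, Int.units_mul_self, one_smul]
  have hinj : Function.Injective fun σ : Equiv.Perm (Fin k) => f ∘ σ := fun σ τ h =>
    Equiv.coe_fn_injective ((Fin.append_injective_iff.1 hfg).1.comp_left h)
  calc hodgeStar 1 k l β (fun i => stdVec (g i))
      = (k.factorial : ℝ)⁻¹ * ∑ f', T f' := hodgeStar_one_apply rfl β _
    _ = (k.factorial : ℝ)⁻¹ * ∑ _σ : Equiv.Perm (Fin k), T f := by
        rw [Fintype.sum_of_injective _ hinj _ T hzero fun σ => (hperm σ).symm]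
    _ = T f := by
        rw [Finset.sum_const, Finset.card_univ, Fintype.card_perm, Fintype.card_fin, nsmul_eq_mul,
          inv_mul_cancel_left₀ (by positivity)]

/-- The Hodge star operator as a linear map. -/
def hodgeStarLinearMap (A : Matrix (Fin n) (Fin n) ℝ) (k l : ℕ) :
    AltForm n k →ₗ[ℝ] AltForm n l where
  toFun := hodgeStar A k l
  map_add' := hodgeStar_add A k l
  map_smul' := hodgeStar_smul A k l

lemma hodgeStarLinearMap_one_injective (h : k + l = n) :
    Function.Injective (hodgeStarLinearMap (1 : Matrix (Fin n) (Fin n) ℝ) k l) := by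
  refine (injective_iff_map_eq_zero _).2 fun β hβ => altForm_ext fun f hf => ?_
  obtain ⟨g, hfg⟩ := exists_injective_append (l := l) (by simpa using h) hf
  have hstar := hodgeStar_one_apply_stdVec h β hfg
  rw [show hodgeStar 1 k l β = 0 from hβ] at hstar
  exact (mul_eq_zero.1 hstar.symm).resolve_right ((detForm_stdVec_ne_zero_iff h f g).2 hfg)

lemma hodgeStar_one_surjective (h : k + l = n) :
    Function.Surjective (hodgeStar (1 : Matrix (Fin n) (Fin n) ℝ) k l) := by
  have hinj : Function.Injective (hodgeStarLinearMap (1 : Matrix (Fin n) (Fin n) ℝ) k l ∘ₗ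
      hodgeStarLinearMap 1 l k) :=
    (hodgeStarLinearMap_one_injective h).comp
      (hodgeStarLinearMap_one_injective ((add_comm l k).trans h))
  exact .of_comp (LinearMap.injective_iff_surjective.1 hinj)

lemma hodgeStar_surjective (hA : A.PosDef) (h : k + l = n) :
    Function.Surjective (hodgeStar A k l) := by
  intro γ
  have hdet : A.det ≠ 0 := hA.det_pos.ne'
  obtain ⟨β, hβ⟩ := hodgeStar_one_surjective h (√A.det • matPullback A⁻¹ γ)
  refine ⟨β, ?_⟩
  rw [hodgeStar_eq_matPullback hA, hβ, map_smul, matPullback_matPullback,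
    Matrix.nonsing_inv_mul A hdet.isUnit, matPullback_one, smul_smul,
    inv_mul_cancel₀ (Real.sqrt_pos.2 hA.det_pos).ne', one_smul]

end HodgeStar

/-! ### Change of the scalar product -/

section GramChange

variable {n k l : ℕ} {A A' : Matrix (Fin n) (Fin n) ℝ}

/-- The operator `⋆' ⋆⁻¹`, where `⋆` and `⋆'` are the Hodge star operators of the scalar products
with Gram matrices `A` and `A'`, in closed form (see `hodgeStar_invFun_hodgeStar`). -/
def gramChange (A A' : Matrix (Fin n) (Fin n) ℝ) : AltForm n k →L[ℝ] AltForm n k :=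
  √(A.det / A'.det) • matPullback (A⁻¹ * A')

lemma gramChange_apply (α : AltForm n k) :
    gramChange A A' α = √(A.det / A'.det) • matPullback (A⁻¹ * A') α := rfl

lemma gramChange_gramChange (hA : A.PosDef) (hA' : A'.PosDef) (α : AltForm n k) :
    gramChange A' A (gramChange A A' α) = α := by
  have hmul : A⁻¹ * A' * (A'⁻¹ * A) = 1 := by
    rw [Matrix.mul_assoc, Matrix.mul_nonsing_inv_cancel_left _ _ hA'.det_pos.ne'.isUnit,
      Matrix.nonsing_inv_mul _ hA.det_pos.ne'.isUnit]
  have hsqrt : √(A.det / A'.det) * √(A'.det / A.det) = 1 := by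
    rw [← inv_div A.det, Real.sqrt_inv,
      mul_inv_cancel₀ (Real.sqrt_pos.2 (div_pos hA.det_pos hA'.det_pos)).ne']
  simp only [gramChange_apply, map_smul, matPullback_matPullback, smul_smul, hmul, hsqrt,
    matPullback_one, one_smul]

lemma matPullback_gramChange {P : Matrix (Fin n) (Fin n) ℝ} (hP : P.det ≠ 0) (α : AltForm n k) :
    matPullback P (gramChange A A' α) =
      gramChange (P.transpose * A * P) (P.transpose * A' * P) (matPullback P α) := by
  have hdet : (P.transpose * A * P).det / (P.transpose * A' * P).det = A.det / A'.det := by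
    simp only [Matrix.det_mul, Matrix.det_transpose]
    rw [mul_div_mul_right _ _ hP, mul_div_mul_left _ _ hP]
  have hmul : P * ((P.transpose * A * P)⁻¹ * (P.transpose * A' * P)) = A⁻¹ * A' * P := by
    have hP' : IsUnit P.transpose.det := by rwa [Matrix.det_transpose, isUnit_iff_ne_zero]
    simp only [Matrix.mul_inv_rev, Matrix.mul_assoc]
    rw [Matrix.mul_nonsing_inv_cancel_left _ _ hP.isUnit,
      Matrix.nonsing_inv_mul_cancel_left _ _ hP']
  simp only [gramChange_apply, map_smul, matPullback_matPullback, hdet, hmul]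

lemma formInner_gramChange (hA : A.IsSymm) (hA' : A'.PosDef) (α β : AltForm n k) :
    formInner A' (gramChange A A' α) β = √(A.det / A'.det) * formInner A α β := by
  have hsymm' : A'.IsSymm := Matrix.isHermitian_iff_isSymm.1 hA'.isHermitian
  rw [gramChange_apply, formInner_smul, formInner_eq_formInner_one hsymm',
    formInner_one_matPullback_left, matPullback_matPullback, Matrix.transpose_mul, hsymm'.eq,
    hA.inv.eq, Matrix.nonsing_inv_mul_cancel_left _ _ hA'.det_pos.ne'.isUnit,
    ← formInner_eq_formInner_one hA]

lemma gramChange_hodgeStar (hA : A.PosDef) (hA' : A'.PosDef) (β : AltForm n k) :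
    gramChange A A' (hodgeStar A k l β) = hodgeStar A' k l β := by
  have hsqrt : √A.det ≠ 0 := (Real.sqrt_pos.2 hA.det_pos).ne'
  rw [hodgeStar_eq_matPullback hA, hodgeStar_eq_matPullback hA', gramChange_apply, map_smul,
    matPullback_matPullback, Matrix.mul_nonsing_inv_cancel_left _ _ hA.det_pos.ne'.isUnit,
    smul_smul, Real.sqrt_div hA.det_pos.le, div_mul_eq_mul_div, mul_inv_cancel₀ hsqrt, one_div]

lemma hodgeStar_gramChange (hA : A.PosDef) (hA' : A'.PosDef) (β : AltForm n k) :
    hodgeStar A' k l (gramChange A A' β) = hodgeStar A k l β := by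
  have hsymm : A.IsSymm := Matrix.isHermitian_iff_isSymm.1 hA.isHermitian
  have hsymm' : A'.IsSymm := Matrix.isHermitian_iff_isSymm.1 hA'.isHermitian
  have hsqrt : √A'.det ≠ 0 := (Real.sqrt_pos.2 hA'.det_pos).ne'
  rw [hodgeStar_eq_hodgeStar_one hsymm, hodgeStar_eq_hodgeStar_one hsymm', gramChange_apply,
    map_smul, matPullback_matPullback,
    Matrix.mul_nonsing_inv_cancel_right _ _ hA'.det_pos.ne'.isUnit, hodgeStar_smul, smul_smul,
    Real.sqrt_div hA.det_pos.le, mul_div_cancel₀ _ hsqrt]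

lemma hodgeStar_invFun_hodgeStar (hA : A.PosDef) (hA' : A'.PosDef) (h : k + l = n)
    (γ : AltForm n l) :
    hodgeStar A' k l (Function.invFun (hodgeStar A k l) γ) = gramChange A A' γ := by
  rw [← gramChange_hodgeStar hA hA', Function.rightInverse_invFun (hodgeStar_surjective hA h) γ]

end GramChange

section Smoothness

variable {V : Type*} [NormedAddCommGroup V] [NormedSpace ℝ V] {s : Set V} {N : WithTop ℕ∞}

lemma contDiffOn_det {ι : Type*} [Fintype ι] [DecidableEq ι] {A : V → Matrix ι ι ℝ}
    (hA : ∀ i j, ContDiffOn ℝ N (fun y => A y i j) s) :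
    ContDiffOn ℝ N (fun y => (A y).det) s := by
  simp only [Matrix.det_apply, Units.smul_def, zsmul_eq_mul]
  exact .sum fun σ _ => contDiffOn_const.mul (contDiffOn_prod fun i _ => hA _ _)

lemma contDiffOn_inv {ι : Type*} [Fintype ι] [DecidableEq ι] {A : V → Matrix ι ι ℝ}
    (hA : ∀ i j, ContDiffOn ℝ N (fun y => A y i j) s) (hdet : ∀ y ∈ s, (A y).det ≠ 0) (i j : ι) :
    ContDiffOn ℝ N (fun y => (A y)⁻¹ i j) s := by
  simp only [Matrix.inv_def, Ring.inverse_eq_inv', Matrix.smul_apply, smul_eq_mul,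
    Matrix.adjugate_apply]
  refine ((contDiffOn_det hA).inv hdet).mul (contDiffOn_det fun a b => ?_)
  simp only [Matrix.updateRow_apply]
  split_ifs
  · exact contDiffOn_const
  · exact hA a b

variable {n k : ℕ}

lemma contDiffOn_altForm_iff {α : V → AltForm n k} :
    ContDiffOn ℝ N α s ↔
      ∀ f : Fin k → Fin n, ContDiffOn ℝ N (fun y => α y fun i => stdVec (f i)) s := by
  rw [← contDiffOn_pi (Φ := fun y (f : Fin k → Fin n) => α y fun i => stdVec (f i))]
  refine ⟨fun h => (components n k).contDiff.comp_contDiffOn h, fun h => ?_⟩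
  obtain ⟨p, hp⟩ := (components n k).toLinearMap.exists_leftInverse_of_injective
    (LinearMap.ker_eq_bot.2 components_injective)
  exact (p.toContinuousLinearMap.contDiff.comp_contDiffOn h).congr fun y _ =>
    (LinearMap.congr_fun hp (α y)).symm

lemma contDiffOn_matPullback {L : V → Matrix (Fin n) (Fin n) ℝ} {α : V → AltForm n k}
    (hL : ∀ i j, ContDiffOn ℝ N (fun y => L y i j) s) (hα : ContDiffOn ℝ N α s) :
    ContDiffOn ℝ N (fun y => matPullback (L y) (α y)) s := by
  refine contDiffOn_altForm_iff.2 fun f => ?_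
  simp only [matPullback_stdVec]
  exact .sum fun h _ => (contDiffOn_prod fun i _ => hL _ _).mul (contDiffOn_altForm_iff.1 hα h)

lemma contDiffOn_gramChange {A A' : V → Matrix (Fin n) (Fin n) ℝ} {α : V → AltForm n k}
    (hA : ∀ i j, ContDiffOn ℝ N (fun y => A y i j) s)
    (hA' : ∀ i j, ContDiffOn ℝ N (fun y => A' y i j) s)
    (hdet : ∀ y ∈ s, (A y).det ≠ 0) (hdet' : ∀ y ∈ s, (A' y).det ≠ 0) (hα : ContDiffOn ℝ N α s) :
    ContDiffOn ℝ N (fun y => gramChange (A y) (A' y) (α y)) s := by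
  have hsqrt : ContDiffOn ℝ N (fun y => √((A y).det / (A' y).det)) s :=
    ((contDiffOn_det hA).div (contDiffOn_det hA') hdet').sqrt
      fun y hy => div_ne_zero (hdet y hy) (hdet' y hy)
  have hmul (i j : Fin n) : ContDiffOn ℝ N (fun y => ((A y)⁻¹ * A' y) i j) s := by
    simp only [Matrix.mul_apply]
    exact .sum fun m _ => (contDiffOn_inv hA hdet i m).mul (hA' m j)
  exact hsqrt.smul (contDiffOn_matPullback hmul hα)

end Smoothness

/-! ### Riemannian metrics in charts -/

lemma posDef_of_bilin {n : ℕ} (B : LinearMap.BilinForm ℝ (Coord n)) (hsymm : ∀ v w, B v w = B w v)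
    (hpos : ∀ v ≠ 0, 0 < B v v) : (Matrix.of fun i j => B (stdVec i) (stdVec j)).PosDef := by
  have h := (LinearMap.BilinForm.posDef_toQuadraticMap_iff_matrix
    (EuclideanSpace.basisFun (Fin n) ℝ).toBasis B ⟨hsymm⟩).1 hpos
  have hgram : LinearMap.BilinForm.toMatrix (EuclideanSpace.basisFun (Fin n) ℝ).toBasis B =
      Matrix.of fun i j => B (stdVec i) (stdVec j) := by
    ext i j
    simp
  rwa [hgram] at h

section Charts

variable {n r : ℕ} {M : Type*} [TopologicalSpace M] [ChartedSpace (Coord n) M]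

/-- The matrix of `paramDeriv x₀ y`, where the tangent space of `M` is identified with `ℝⁿ`. -/
def paramMatrix (x₀ : M) (y : Coord n) : Matrix (Fin n) (Fin n) ℝ :=
  (Matrix.toEuclideanCLM (n := Fin n) (𝕜 := ℝ)).symm (paramDeriv x₀ y : Coord n →L[ℝ] Coord n)

lemma toEuclideanCLM_paramMatrix (x₀ : M) (y : Coord n) :
    Matrix.toEuclideanCLM (𝕜 := ℝ) (paramMatrix x₀ y) =
      (paramDeriv x₀ y : Coord n →L[ℝ] Coord n) :=
  (Matrix.toEuclideanCLM (n := Fin n) (𝕜 := ℝ)).apply_symm_apply _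

lemma inChart_eq_matPullback (x₀ : M) (η : FormField (Coord n) M r) (y : Coord n) :
    inChart x₀ η y =
      matPullback (paramMatrix x₀ y) (η ((extChartAt 𝓘(ℝ, Coord n) x₀).symm y)) := by
  rw [matPullback, toEuclideanCLM_paramMatrix]
  rfl

lemma paramDeriv_apply (x₀ : M) (y v : Coord n) :
    (paramDeriv x₀ y v : Coord n) = Matrix.toEuclideanCLM (𝕜 := ℝ) (paramMatrix x₀ y) v :=
  (DFunLike.congr_fun (toEuclideanCLM_paramMatrix x₀ y) v).symm

variable [IsManifold 𝓘(ℝ, Coord n) ∞ M]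

lemma metricInChart_eq (g : Metric (Coord n) M) (x₀ : M) (y : Coord n) :
    metricInChart g x₀ y = (paramMatrix x₀ y).transpose *
      metricAt g ((extChartAt 𝓘(ℝ, Coord n) x₀).symm y) * paramMatrix x₀ y := by
  ext i j
  let G : Coord n →L[ℝ] Coord n →L[ℝ] ℝ := g.inner ((extChartAt 𝓘(ℝ, Coord n) x₀).symm y)
  change G (paramDeriv x₀ y (stdVec i) : Coord n) (paramDeriv x₀ y (stdVec j) : Coord n) =
    ((paramMatrix x₀ y).transpose * Matrix.of (fun i j => G (stdVec i) (stdVec j)) *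
      paramMatrix x₀ y) i j
  rw [paramDeriv_apply, paramDeriv_apply, toEuclideanCLM_stdVec, toEuclideanCLM_stdVec]
  simp only [map_sum, map_smul, sum_apply, smul_apply,
    Matrix.mul_apply, Matrix.transpose_apply, Matrix.of_apply, smul_eq_mul, Finset.sum_mul]
  exact Finset.sum_congr rfl fun a _ => by rw [mul_comm, Finset.sum_mul]

lemma metricAt_posDef (g : Metric (Coord n) M) (x : M) : (metricAt g x).PosDef :=
  posDef_of_bilin (ContinuousLinearMap.toLinearMap₁₂
    (g.inner x : Coord n →L[ℝ] Coord n →L[ℝ] ℝ)) (g.symm x) (g.pos x)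

lemma det_paramMatrix_ne_zero (x₀ : M) {y : Coord n}
    (hy : y ∈ (extChartAt 𝓘(ℝ, Coord n) x₀).target) : (paramMatrix x₀ y).det ≠ 0 := by
  refine fun h => ?_
  obtain ⟨v, hv, hPv⟩ := Matrix.exists_mulVec_eq_zero_iff.2 h
  have hparam : Matrix.toEuclideanCLM (𝕜 := ℝ) (paramMatrix x₀ y) (WithLp.toLp 2 v) = 0 := by
    rw [Matrix.toEuclideanCLM_toLp, hPv, WithLp.toLp_zero]
  have hzero := paramDeriv_injective x₀ hy ((paramDeriv_apply x₀ y _).trans hparam)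
  exact hv (by simpa using hzero)

lemma metricInChart_posDef (g : Metric (Coord n) M) (x₀ : M) {y : Coord n}
    (hy : y ∈ (extChartAt 𝓘(ℝ, Coord n) x₀).target) : (metricInChart g x₀ y).PosDef := by
  rw [metricInChart_eq, ← Matrix.conjTranspose_eq_transpose_of_trivial]
  exact (metricAt_posDef g _).conjTranspose_mul_mul_same <| Matrix.mulVec_injective_iff_isUnit.2 <|
    (Matrix.isUnit_iff_isUnit_det _).2 (det_paramMatrix_ne_zero x₀ hy).isUnit

lemma chartDeriv_self (x : M) :
    (chartDeriv x x : Coord n →L[ℝ] Coord n) = ContinuousLinearMap.id ℝ (Coord n) := by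
  have := IsManifold.of_le (I := 𝓘(ℝ, Coord n)) (M := M) (m := 1) (n := ∞) (by simp)
  have h := mfderiv_chartAt_eq_tangentCoordChange (I := 𝓘(ℝ, Coord n)) (mem_chart_source _ x)
  ext1 v
  exact (DFunLike.congr_fun h v).trans
    (tangentCoordChange_self (I := 𝓘(ℝ, Coord n)) (mem_extChartAt_source x))

lemma paramMatrix_self (x : M) : paramMatrix x (extChartAt 𝓘(ℝ, Coord n) x x) = 1 := by
  have := IsManifold.of_le (I := 𝓘(ℝ, Coord n)) (M := M) (m := 1) (n := ∞) (by simp)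
  have h := mfderiv_extChartAt_comp_mfderivWithin_extChartAt_symm (I := 𝓘(ℝ, Coord n))
    (mem_extChartAt_target (I := 𝓘(ℝ, Coord n)) x)
  rw [modelWithCornersSelf_coe, Set.range_id, mfderivWithin_univ] at h
  have key (p : M) (hp : p = x) (D : Coord n →L[ℝ] Coord n)
      (hD : (chartDeriv x p : Coord n →L[ℝ] Coord n).comp D =
        ContinuousLinearMap.id ℝ (Coord n)) : D = ContinuousLinearMap.id ℝ (Coord n) := by
    subst hp
    rwa [chartDeriv_self] at hD
  rw [paramMatrix, key _ (extChartAt_to_inv x) (paramDeriv x (extChartAt 𝓘(ℝ, Coord n) x x)) h]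
  exact map_one (Matrix.toEuclideanCLM (n := Fin n) (𝕜 := ℝ)).symm

lemma metricInChart_self (g : Metric (Coord n) M) (x : M) :
    metricInChart g x (extChartAt 𝓘(ℝ, Coord n) x x) = metricAt g x := by
  rw [metricInChart_eq, paramMatrix_self, extChartAt_to_inv, Matrix.transpose_one, Matrix.one_mul,
    Matrix.mul_one]

lemma contDiffOn_metricInChart (g : Metric (Coord n) M) (x₀ : M) (i j : Fin n) :
    ContDiffOn ℝ ∞ (fun y => metricInChart g x₀ y i j) (extChartAt 𝓘(ℝ, Coord n) x₀).target :=
  contDiffOn_metric g x₀ (stdVec i) (stdVec j)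

end Charts

/-! ### The bundle map `⋆' ⋆⁻¹` -/

section StarChange

variable {n r : ℕ} {M : Type*} [TopologicalSpace M] [ChartedSpace (Coord n) M]
  [IsManifold 𝓘(ℝ, Coord n) ∞ M] (g g' : Metric (Coord n) M)

lemma starChange_apply (η : FormField (Coord n) M r) (x : M) :
    starChange g g' η x = gramChange (metricAt g x) (metricAt g' x) (η x) := by
  rcases le_or_gt r n with hrn | hnr
  · exact hodgeStar_invFun_hodgeStar (metricAt_posDef g x) (metricAt_posDef g' x)
      (Nat.sub_add_cancel hrn) _
  · have := subsingleton_altForm hnr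
    exact Subsingleton.elim (α := AltForm n r) _ _

lemma starChange_starChange (η : FormField (Coord n) M r) :
    starChange g' g (starChange g g' η) = η := by
  funext x
  rw [starChange_apply, starChange_apply]
  exact gramChange_gramChange (metricAt_posDef g x) (metricAt_posDef g' x) _

/-- The bundle map `⋆' ⋆⁻¹` as a linear automorphism of the space of fields of `r`-forms. -/
def starChangeEquiv : FormField (Coord n) M r ≃ₗ[ℝ] FormField (Coord n) M r where
  toFun := starChange g g'
  invFun := starChange g' g
  left_inv := starChange_starChange g g'
  right_inv := starChange_starChange g' g
  map_add' η θ := by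
    funext x
    simp only [FormField.add_apply, starChange_apply]
    exact map_add (gramChange _ _) _ _
  map_smul' c η := by
    funext x
    simp only [FormField.smul_apply, starChange_apply]
    exact map_smul (gramChange _ _) _ _

lemma starChange_mem_iff_of_forall_mem {S : Set (FormField (Coord n) M r)}
    (hS : ∀ g g' : Metric (Coord n) M, ∀ η ∈ S, starChange g g' η ∈ S)
    {η : FormField (Coord n) M r} : starChange g g' η ∈ S ↔ η ∈ S :=
  ⟨fun h => starChange_starChange g g' η ▸ hS g' g _ h, hS g g' η⟩

lemma inChart_starChange (η : FormField (Coord n) M r) (x₀ : M) {y : Coord n}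
    (hy : y ∈ (extChartAt 𝓘(ℝ, Coord n) x₀).target) :
    inChart x₀ (starChange g g' η) y =
      gramChange (metricInChart g x₀ y) (metricInChart g' x₀ y) (inChart x₀ η y) := by
  rw [inChart_eq_matPullback, inChart_eq_matPullback, metricInChart_eq, metricInChart_eq]
  exact (congrArg (matPullback _) (starChange_apply g g' η _)).trans
    (matPullback_gramChange (det_paramMatrix_ne_zero x₀ hy) _)

lemma starChange_mem_smoothForms_iff {η : FormField (Coord n) M r} :
    starChange g g' η ∈ smoothForms (Coord n) M r ↔ η ∈ smoothForms (Coord n) M r := by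
  refine starChange_mem_iff_of_forall_mem (r := r) g g' (S := smoothForms (Coord n) M r)
    fun g g' η hη x₀ => ?_
  exact (contDiffOn_gramChange (contDiffOn_metricInChart g x₀) (contDiffOn_metricInChart g' x₀)
    (fun _ => det_metricInChart_ne_zero g x₀) (fun _ => det_metricInChart_ne_zero g' x₀)
    (hη x₀)).congr fun _ => inChart_starChange g g' η x₀

lemma starChange_mem_compactlySupported_iff {η : FormField (Coord n) M r} :
    starChange g g' η ∈ compactlySupported (Coord n) M r ↔
      η ∈ compactlySupported (Coord n) M r := by
  refine starChange_mem_iff_of_forall_mem (r := r) g g' (S := compactlySupported (Coord n) M r) ?_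
  rintro g g' η ⟨K, hK, hη⟩
  refine ⟨K, hK, fun x hx => ?_⟩
  rw [starChange_apply, hη x hx]
  exact map_zero (gramChange _ _)

lemma codiff_apply (η : FormField (Coord n) M (r + 1)) (x : M) :
    codiff g η x = (-1 : ℝ) ^ (n * (r + 1) + n + 1) •
      hodgeStar (metricAt g x) (n - (r + 1) + 1) r
        (extDeriv (fun y => hodgeStar (metricInChart g x y) (r + 1) (n - (r + 1)) (inChart x η y))
          (extChartAt 𝓘(ℝ, Coord n) x x)) := by
  have hself (β : AltForm n r) : ContinuousAlternatingMap.compContinuousLinearMap β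
      (chartDeriv x x : Coord n →L[ℝ] Coord n) = β := by
    rw [chartDeriv_self]
    rfl
  rw [← metricInChart_self]
  exact hself _

lemma codiff_starChange (η : FormField (Coord n) M (r + 1)) :
    codiff g' (starChange g g' η) = starChange g g' (codiff g η) := by
  funext x
  have hstar : (fun y => hodgeStar (metricInChart g' x y) (r + 1) (n - (r + 1))
        (inChart x (starChange g g' η) y)) =ᶠ[𝓝 (extChartAt 𝓘(ℝ, Coord n) x x)]
      fun y => hodgeStar (metricInChart g x y) (r + 1) (n - (r + 1)) (inChart x η y) := by
    filter_upwards [extChartAt_target_mem_nhds x] with y hy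
    rw [inChart_starChange g g' η x hy,
      hodgeStar_gramChange (metricInChart_posDef g x hy) (metricInChart_posDef g' x hy)]
  rw [starChange_apply, codiff_apply, codiff_apply, hstar.extDeriv_eq, map_smul,
    gramChange_hodgeStar (metricAt_posDef g x) (metricAt_posDef g' x)]

lemma starChange_mem_coclosedForms_iff {η : FormField (Coord n) M r} :
    starChange g g' η ∈ coclosedForms g' r ↔ η ∈ coclosedForms g r := by
  cases r with
  | zero => exact starChange_mem_smoothForms_iff g g'
  | succ r =>
    refine and_congr (starChange_mem_smoothForms_iff g g') ?_
    rw [codiff_starChange]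
    exact (starChangeEquiv g g').map_eq_zero_iff

lemma starChange_mem_codiffImage_iff {W W' : Submodule ℝ (FormField (Coord n) M (r + 1))}
    (hW : ∀ η, starChange g g' η ∈ W' ↔ η ∈ W) {θ : FormField (Coord n) M r} :
    starChange g g' θ ∈ codiffImage g' W' ↔ θ ∈ codiffImage g W := by
  refine (starChangeEquiv g g').surjective.exists.trans (exists_congr fun η => ?_)
  refine and_congr (hW η) (and_congr (starChange_mem_smoothForms_iff g g') ?_)
  exact (codiff_starChange g g' η).congr_left.trans (starChangeEquiv g g').injective.eq_iff

end StarChange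

section Cohomology

variable {n : ℕ} {M : Type*} [TopologicalSpace M] [ChartedSpace (Coord n) M]
  [IsManifold 𝓘(ℝ, Coord n) ∞ M] {g g' : Metric (Coord n) M}
  {W W' : (k : ℕ) → Submodule ℝ (FormField (Coord n) M k)}

lemma starChange_mem_cocycles_iff (hW : ∀ k η, starChange g g' η ∈ W' k ↔ η ∈ W k) {r : ℕ}
    {η : FormField (Coord n) M r} : starChange g g' η ∈ cocycles W' g' r ↔ η ∈ cocycles W g r :=
  and_congr (hW r η) (starChange_mem_coclosedForms_iff g g')

/-- The isomorphism of the spaces of cocycles given by `⋆' ⋆⁻¹`, for graded spaces `W` and `W'` of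
forms that correspond to each other under `⋆' ⋆⁻¹`. -/
def cocyclesEquiv (hW : ∀ k η, starChange g g' η ∈ W' k ↔ η ∈ W k) (r : ℕ) :
    cocycles W g r ≃ₗ[ℝ] cocycles W' g' r :=
  (LinearEquiv.ofEq _ _ (Submodule.ext fun _ => (starChange_mem_cocycles_iff hW).symm)).trans
    ((starChangeEquiv g g').ofSubmodule' (cocycles W' g' r))

/-- The isomorphism of cohomologies induced by `cocyclesEquiv`. -/
def cohomologyEquiv (hW : ∀ k η, starChange g g' η ∈ W' k ↔ η ∈ W k) (r : ℕ) :
    Cohomology W g r ≃ₗ[ℝ] Cohomology W' g' r :=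
  Submodule.Quotient.equiv _ _ (cocyclesEquiv hW r) <| by
    have hcomap : (codiffImage g (W (r + 1))).comap (cocycles W g r).subtype =
        ((codiffImage g' (W' (r + 1))).comap (cocycles W' g' r).subtype).comap
          (cocyclesEquiv hW r).toLinearMap :=
      Submodule.ext fun _ => (starChange_mem_codiffImage_iff g g' (hW (r + 1))).symm
    rw [hcomap]
    exact Submodule.map_comap_eq_of_surjective (cocyclesEquiv hW r).surjective _

end Cohomology

/-! ### Densities and suprema of measures -/

lemma withDensity_mono_measure {α : Type*} [MeasurableSpace α] {μ ν : Measure α} (h : μ ≤ ν)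
    (f : α → ENNReal) : μ.withDensity f ≤ ν.withDensity f := by
  refine Measure.le_iff.2 fun s hs => ?_
  rw [withDensity_apply f hs, withDensity_apply f hs]
  exact lintegral_mono' (Measure.restrict_mono le_rfl h) le_rfl

lemma withDensity_iSup {α ι : Type*} [MeasurableSpace α] (μ : ι → Measure α)
    {f : α → ENNReal} (hf : Measurable f) (hzero : ∀ x, f x ≠ 0) (htop : ∀ x, f x ≠ ⊤) :
    (⨆ i, μ i).withDensity f = ⨆ i, (μ i).withDensity f := by
  refine le_antisymm ?_ (iSup_le fun i => withDensity_mono_measure (le_iSup μ i) f)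
  have hinv (ν : Measure α) : (ν.withDensity f⁻¹).withDensity f = ν := by
    have := withDensity_inv_same (μ := ν) (f := f⁻¹) hf.inv
      (.of_forall fun x => ENNReal.inv_ne_zero.2 (htop x))
      (.of_forall fun x => ENNReal.inv_ne_top.2 (hzero x))
    simpa only [Pi.inv_apply, inv_inv] using this
  have hle : ⨆ i, μ i ≤ (⨆ i, (μ i).withDensity f).withDensity f⁻¹ := iSup_le fun i =>
    (withDensity_inv_same (μ := μ i) hf (.of_forall hzero) (.of_forall htop)).ge.trans
      (withDensity_mono_measure (le_iSup (fun i => (μ i).withDensity f) i) _)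
  exact (withDensity_mono_measure hle f).trans_eq (hinv _)

lemma map_withDensity_comp {α β : Type*} [MeasurableSpace α] [MeasurableSpace β]
    {μ : Measure α} {φ : α → β} (hφ : AEMeasurable φ μ) {f : β → ENNReal} (hf : Measurable f) :
    (μ.withDensity (f ∘ φ)).map φ = (μ.map φ).withDensity f := by
  ext s hs
  rw [Measure.map_apply_of_aemeasurable (hφ.mono_ac (withDensity_absolutelyContinuous _ _)) hs,
    withDensity_apply f hs, Measure.restrict_map_of_aemeasurable hφ hs,
    lintegral_map' hf.aemeasurable (hφ.mono_measure Measure.restrict_le_self)]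
  exact withDensity_apply₀ _ (hφ.nullMeasurableSet_preimage hs)

/-! ### The change of the Riemannian volume -/

section Volume

variable {n r : ℕ} {M : Type*} [TopologicalSpace M] [ChartedSpace (Coord n) M]
  [IsManifold 𝓘(ℝ, Coord n) ∞ M] (g g' : Metric (Coord n) M)

/-- The density `√(det g' / det g)` of the volume of `g'` with respect to the volume of `g`. The
quotient of the Gram determinants does not depend on the basis of `T_x M`. -/
def volumeRatio (x : M) : ℝ := √((metricAt g' x).det / (metricAt g x).det)

lemma volumeRatio_pos (x : M) : 0 < volumeRatio g g' x :=
  Real.sqrt_pos.2 (div_pos (metricAt_posDef g' x).det_pos (metricAt_posDef g x).det_pos)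

lemma volumeRatio_extChartAt_symm (x₀ : M) {y : Coord n}
    (hy : y ∈ (extChartAt 𝓘(ℝ, Coord n) x₀).target) :
    volumeRatio g g' ((extChartAt 𝓘(ℝ, Coord n) x₀).symm y) =
      √((metricInChart g' x₀ y).det / (metricInChart g x₀ y).det) := by
  have hdet := det_paramMatrix_ne_zero x₀ hy
  rw [volumeRatio, metricInChart_eq, metricInChart_eq]
  congr 1
  simp only [Matrix.det_mul, Matrix.det_transpose]
  field_simp

lemma continuousOn_det_metricInChart (x₀ : M) :
    ContinuousOn (fun y => (metricInChart g x₀ y).det) (extChartAt 𝓘(ℝ, Coord n) x₀).target :=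
  (contDiffOn_det (contDiffOn_metricInChart g x₀)).continuousOn

lemma continuous_volumeRatio : Continuous (volumeRatio g g') := by
  refine continuous_iff_continuousAt.2 fun x => ?_
  have hchart : ContinuousOn
      (fun y => √((metricInChart g' x y).det / (metricInChart g x y).det))
      (extChartAt 𝓘(ℝ, Coord n) x).target :=
    ((continuousOn_det_metricInChart g' x).div (continuousOn_det_metricInChart g x)
      fun _ => det_metricInChart_ne_zero g x).sqrt
  refine ((hchart.continuousAt (extChartAt_target_mem_nhds x)).comp
    (continuousAt_extChartAt (I := 𝓘(ℝ, Coord n)) x)).congr ?_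
  filter_upwards [extChartAt_source_mem_nhds (I := 𝓘(ℝ, Coord n)) x] with z hz
  have heq := volumeRatio_extChartAt_symm g g' x ((extChartAt 𝓘(ℝ, Coord n) x).map_source hz)
  rw [(extChartAt 𝓘(ℝ, Coord n) x).left_inv hz] at heq
  exact heq.symm

lemma volumeRatio_mul_pointInner_starChange (α β : FormField (Coord n) M r) (x : M) :
    volumeRatio g g' x * pointInner g' (starChange g g' α) β x = pointInner g α β x := by
  have hpos := (metricAt_posDef g x).det_pos
  have hpos' := (metricAt_posDef g' x).det_pos
  have hinner : pointInner g' (starChange g g' α) β x =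
      √((metricAt g x).det / (metricAt g' x).det) * pointInner g α β x := by
    rw [pointInner, starChange_apply]
    exact formInner_gramChange (Matrix.isHermitian_iff_isSymm.1 (metricAt_posDef g x).isHermitian)
      (metricAt_posDef g' x) _ _
  rw [hinner, volumeRatio, ← mul_assoc, ← Real.sqrt_mul (div_pos hpos' hpos).le,
    div_mul_div_cancel₀ hpos.ne', div_self hpos'.ne', Real.sqrt_one, one_mul]

variable [MeasurableSpace M] [BorelSpace M]

lemma measurable_ofReal_volumeRatio : Measurable fun x => ENNReal.ofReal (volumeRatio g g' x) :=
  (continuous_volumeRatio g g').measurable.ennreal_ofReal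

lemma chartVolume_eq_withDensity (x₀ : M) :
    chartVolume g' x₀ =
      (chartVolume g x₀).withDensity fun x => ENNReal.ofReal (volumeRatio g g' x) := by
  have htarget : MeasurableSet (extChartAt 𝓘(ℝ, Coord n) x₀).target :=
    (isOpen_extChartAt_target x₀).measurableSet
  have hsymm : AEMeasurable (extChartAt 𝓘(ℝ, Coord n) x₀).symm
      (volume.restrict (extChartAt 𝓘(ℝ, Coord n) x₀).target) :=
    (continuousOn_extChartAt_symm x₀).aemeasurable htarget
  have hdensity : AEMeasurable (fun y => ENNReal.ofReal √(metricInChart g x₀ y).det)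
      (volume.restrict (extChartAt 𝓘(ℝ, Coord n) x₀).target) :=
    ((continuousOn_det_metricInChart g x₀).sqrt.aemeasurable htarget).ennreal_ofReal
  have hratio := measurable_ofReal_volumeRatio g g'
  rw [chartVolume, chartVolume, ← map_withDensity_comp
    (hsymm.mono_ac (withDensity_absolutelyContinuous _ _)) hratio,
    ← withDensity_mul₀ hdensity (hratio.comp_aemeasurable hsymm)]
  refine congrArg (Measure.map _) (withDensity_congr_ae ?_)
  filter_upwards [ae_restrict_mem htarget] with y hy
  have hpos := (metricInChart_posDef g x₀ hy).det_pos
  rw [Pi.mul_apply, Function.comp_apply, volumeRatio_extChartAt_symm g g' x₀ hy,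
    ← ENNReal.ofReal_mul (Real.sqrt_nonneg _), ← Real.sqrt_mul hpos.le,
    mul_div_cancel₀ _ hpos.ne']

lemma riemannianVolume_eq_withDensity :
    riemannianVolume g' =
      (riemannianVolume g).withDensity fun x => ENNReal.ofReal (volumeRatio g g' x) := by
  rw [riemannianVolume, riemannianVolume, withDensity_iSup _ (measurable_ofReal_volumeRatio g g')
    (fun x => (ENNReal.ofReal_pos.2 (volumeRatio_pos g g' x)).ne') fun _ => ENNReal.ofReal_ne_top]
  exact iSup_congr (chartVolume_eq_withDensity g g')

lemma L2Orthogonal_starChange_iff {α β : FormField (Coord n) M r} :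
    L2Orthogonal g' (starChange g g' α) β ↔ L2Orthogonal g α β := by
  have hmeas := measurable_ofReal_volumeRatio g g'
  have htop : ∀ᵐ x ∂riemannianVolume g, ENNReal.ofReal (volumeRatio g g' x) < ⊤ :=
    .of_forall fun _ => ENNReal.ofReal_lt_top
  rw [L2Orthogonal, L2Orthogonal, riemannianVolume_eq_withDensity g g',
    integrable_withDensity_iff_integrable_smul' hmeas htop,
    integral_withDensity_eq_integral_toReal_smul hmeas htop]
  simp only [ENNReal.toReal_ofReal (volumeRatio_pos g g' _).le, smul_eq_mul,
    volumeRatio_mul_pointInner_starChange]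

end Volume

section Antibasic

variable {n p r : ℕ} {M : Type*} [TopologicalSpace M] [ChartedSpace (Coord n) M]
  [IsManifold 𝓘(ℝ, Coord n) ∞ M] [MeasurableSpace M] [BorelSpace M]
  (F : Foliation n p M) (g g' : Metric (Coord n) M)

lemma Foliation.starChange_mem_antibasicForms_iff {η : FormField (Coord n) M r} :
    starChange g g' η ∈ F.antibasicForms g' r ↔ η ∈ F.antibasicForms g r :=
  and_congr (starChange_mem_smoothForms_iff g g') <|
    forall₂_congr fun _ _ => L2Orthogonal_starChange_iff g g'

lemma Foliation.starChange_mem_compactAntibasicForms_iff {η : FormField (Coord n) M r} :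
    starChange g g' η ∈ F.compactAntibasicForms g' r ↔ η ∈ F.compactAntibasicForms g r :=
  and_congr (F.starChange_mem_antibasicForms_iff g g') (starChange_mem_compactlySupported_iff g g')

end Antibasic

end AntibasicCohomology

end

open AntibasicCohomology in
theorem mainTheorem1_general {n p : ℕ} {M : Type*} [TopologicalSpace M]
    [ChartedSpace (Coord n) M] [IsManifold 𝓘(ℝ, Coord n) ∞ M]
    [MeasurableSpace M] [BorelSpace M] (F : Foliation n p M) (g g' : Metric (Coord n) M) (r : ℕ) :
    (∃ Φ : antibasicCohomology F g r ≃ₗ[ℝ] antibasicCohomology F g' r,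
      ∀ ψ : cocycles (F.antibasicForms g) g r,
        ∃ h : starChange g g' ψ.1 ∈ cocycles (F.antibasicForms g') g' r,
          Φ (cohomologyClass (F.antibasicForms g) g r ψ) =
            cohomologyClass (F.antibasicForms g') g' r ⟨starChange g g' ψ.1, h⟩) ∧
    (∃ Φ : compactAntibasicCohomology F g r ≃ₗ[ℝ] compactAntibasicCohomology F g' r,
      ∀ ψ : cocycles (F.compactAntibasicForms g) g r,
        ∃ h : starChange g g' ψ.1 ∈ cocycles (F.compactAntibasicForms g') g' r,
          Φ (cohomologyClass (F.compactAntibasicForms g) g r ψ) =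
            cohomologyClass (F.compactAntibasicForms g') g' r ⟨starChange g g' ψ.1, h⟩) := by
  have antibasic (k : ℕ) (η : FormField (Coord n) M k) :=
    F.starChange_mem_antibasicForms_iff g g' (η := η)
  have compact (k : ℕ) (η : FormField (Coord n) M k) :=
    F.starChange_mem_compactAntibasicForms_iff g g' (η := η)
  exact ⟨⟨cohomologyEquiv antibasic r, fun ψ => ⟨(cocyclesEquiv antibasic r ψ).2, rfl⟩⟩,
    ⟨cohomologyEquiv compact r, fun ψ => ⟨(cocyclesEquiv compact r ψ).2, rfl⟩⟩⟩

open AntibasicCohomology in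
theorem mainTheorem1 {n p : ℕ} {M : Type*} [TopologicalSpace M] [T2Space M]
    [SecondCountableTopology M] [ChartedSpace (Coord n) M] [IsManifold 𝓘(ℝ, Coord n) ∞ M]
    [MeasurableSpace M] [BorelSpace M] (F : Foliation n p M) (g g' : Metric (Coord n) M) (r : ℕ) :
    (∃ Φ : antibasicCohomology F g r ≃ₗ[ℝ] antibasicCohomology F g' r,
      ∀ ψ : cocycles (F.antibasicForms g) g r,
        ∃ h : starChange g g' ψ.1 ∈ cocycles (F.antibasicForms g') g' r,
          Φ (cohomologyClass (F.antibasicForms g) g r ψ) =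
            cohomologyClass (F.antibasicForms g') g' r ⟨starChange g g' ψ.1, h⟩) ∧
    (∃ Φ : compactAntibasicCohomology F g r ≃ₗ[ℝ] compactAntibasicCohomology F g' r,
      ∀ ψ : cocycles (F.compactAntibasicForms g) g r,
        ∃ h : starChange g g' ψ.1 ∈ cocycles (F.compactAntibasicForms g') g' r,
          Φ (cohomologyClass (F.compactAntibasicForms g) g r ψ) =
            cohomologyClass (F.compactAntibasicForms g') g' r ⟨starChange g g' ψ.1, h⟩) :=
  mainTheorem1_general F g g' r
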